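/- All registers are finite-dimensional and $\log=\log_2$. Let $\mathcal N_{AS\to B}$ be a quantum channel (a completely positive trace-preserving map), let $|\tau\rangle_{SS'}$ be a pure state whose register $S$ is an input of the channel and whose register $S'$ is held by the sender Alice, and let $\tau_S=\mathrm{Tr}_{S'}|\tau\rangle\langle\tau|$. For $\mathrm{err}\in\mathbb R$ and $R\ge 0$, an $(R,\mathrm{err})$-entanglement-assisted code for $\mathcal N_{AS\to B}$ with state $|\tau\rangle_{SS'}$ consists of a pure state $|\theta\rangle_{E_AE_B}$ shared between Alice ($E_A$) and Bob ($E_B$), an encoding channel $\mathcal E: ME_AS'\to A$ and a decoding channel $\mathcal D: BE_B\to M'$, where $M\equiv M'$ are registers with orthonormal basis the message set $[2^R]=\{1,\dots,\lfloor 2^R\rfloor\}$, such that for every message $m$ the output of $\mathcal D\circ\mathcal N\circ\mathcal E$ on $|m\rangle\langle m|_M\otimes|\theta\rangle\langle\theta|_{E_AE_B}\otimes|\tau\rangle\langle\tau|_{SS'}$, measured in the basis of $M'$, satisfies $\Pr(M'\ne m\mid M=m)\le \mathrm{err}$. For states $\rho,\sigma$ on the same register and $\varepsilon\in(0,1)$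 let $$D_H^{\varepsilon}(\rho\|\sigma)=\sup_{0\preceq\Lambda\preceq I,\ \mathrm{Tr}(\Lambda\rho)\ge 1-\varepsilon}\log\frac{1}{\mathrm{Tr}(\Lambda\sigma)}\in[0,+\infty].$$ Theorem. Let $\varepsilon,\delta\in(0,1)$ with $\delta\le\varepsilon$. For every real $R\ge 0$ with $$R\le \sup_{\psi_{ASB'}:\ \psi_{SB'}=\tau_S\otimes\psi_{B'}} D_H^{\varepsilon}\big(\mathcal N_{AS\to B}(\psi_{ASB'})\,\big\|\,\mathcal N_{AS\to B}(\psi_{AS})\otimes\psi_{B'}\big)-\log\frac{4\varepsilon}{\delta^2},$$ where the supremum is over all finite-dimensional registers $B'$ and all states $\psi_{ASB'}$ with $\psi_{SB'}=\tau_S\otimes\psi_{B'}$, there exists an $(R,\varepsilon+2\delta)$-entanglement-assisted code for $\mathcal N_{AS\to B}$ with state $|\tau\rangle_{SS'}$. -/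

import Mathlib

open scoped Kronecker ComplexOrder

namespace QIT

/-- Density matrices on the register with orthonormal basis `ι`. -/
def IsState {ι : Type*} [Fintype ι] (ρ : Matrix ι ι ℂ) : Prop :=
  ρ.PosSemidef ∧ ρ.trace = 1

/-- Unit vectors (pure states) on the register with orthonormal basis `ι`. -/
def IsUnitVec {ι : Type*} [Fintype ι] (v : ι → ℂ) : Prop :=
  ∑ i, ‖v i‖ ^ 2 = 1

/-- The rank-one operator `|v⟩⟨v|`. -/
def ketbra {ι : Type*} (v : ι → ℂ) : Matrix ι ι ℂ :=
  Matrix.vecMulVec v (star v)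

/-- Partial trace over the first tensor factor. -/
def trFst {ι κ : Type*} [Fintype ι] (X : Matrix (ι × κ) (ι × κ) ℂ) : Matrix κ κ ℂ :=
  Matrix.of fun k k' => ∑ i, X (i, k) (i, k')

/-- Partial trace over the second tensor factor. -/
def trSnd {ι κ : Type*} [Fintype κ] (X : Matrix (ι × κ) (ι × κ) ℂ) : Matrix ι ι ℂ :=
  Matrix.of fun i i' => ∑ k, X (i, k) (i', k)

/-- The operation `Φ ⊗ id` with the identity acting on the register `κ`. -/
def tensorId {ι ι' : Type*} (Φ : Matrix ι ι ℂ →ₗ[ℂ] Matrix ι' ι' ℂ) (κ : Type*)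
    (X : Matrix (ι × κ) (ι × κ) ℂ) : Matrix (ι' × κ) (ι' × κ) ℂ :=
  Matrix.of fun x y => Φ (Matrix.of fun i j => X (i, x.2) (j, y.2)) x.1 y.1

/-- Quantum channels: completely positive trace preserving linear maps. -/
structure Channel (ι ι' : Type*) [Fintype ι] [Fintype ι'] where
  toLin : Matrix ι ι ℂ →ₗ[ℂ] Matrix ι' ι' ℂ
  completelyPositive : ∀ (k : ℕ) (X : Matrix (ι × Fin k) (ι × Fin k) ℂ),
    X.PosSemidef → (tensorId toLin (Fin k) X).PosSemidef
  tracePreserving : ∀ X, (toLin X).trace = X.trace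

/-- `log₂ (1 / t)` for `t ≥ 0`, with the value `+∞` at `t = 0`. -/
noncomputable def logInv (t : ℝ) : EReal :=
  if t = 0 then ⊤ else ((Real.logb 2 (1 / t) : ℝ) : EReal)

/-- The smooth hypothesis testing divergence `D_H^ε(ρ ‖ σ)`, in bits. -/
noncomputable def hypDiv {ι : Type*} [Fintype ι] [DecidableEq ι] (ε : ℝ)
    (ρ σ : Matrix ι ι ℂ) : EReal :=
  ⨆ (Λ : Matrix ι ι ℂ) (_ : Λ.PosSemidef ∧ (1 - Λ).PosSemidef ∧ 1 - ε ≤ (Λ * ρ).trace.re),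
    logInv (Λ * σ).trace.re

/-- The marginal on `S B'` of an operator on `A S B'`. -/
def margSB {A S B' : Type*} [Fintype A] (ψ : Matrix ((A × S) × B') ((A × S) × B') ℂ) :
    Matrix (S × B') (S × B') ℂ :=
  Matrix.of fun x y => ∑ a, ψ ((a, x.1), x.2) ((a, y.1), y.2)

/-- The states `ψ_{ASB'}` with `ψ_{SB'} = τ_S ⊗ ψ_{B'}`. -/
def IsAdmissible {A S B' : Type*} [Fintype A] [Fintype S] [Fintype B'] (τS : Matrix S S ℂ)
    (ψ : Matrix ((A × S) × B') ((A × S) × B') ℂ) : Prop :=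
  IsState ψ ∧ margSB ψ = τS ⊗ₖ trFst ψ

/-- The supremum, over all finite-dimensional registers `B'` and all states `ψ_{ASB'}` with
`ψ_{SB'} = τ_S ⊗ ψ_{B'}`, of `D_H^ε(N(ψ_{ASB'}) ‖ N(ψ_{AS}) ⊗ ψ_{B'})`. -/
noncomputable def maxHypDiv {A S B : Type*} [Fintype A] [Fintype S] [Fintype B] [DecidableEq B]
    (N : Channel (A × S) B) (τS : Matrix S S ℂ) (ε : ℝ) : EReal :=
  ⨆ (n : ℕ) (ψ : Matrix ((A × S) × Fin n) ((A × S) × Fin n) ℂ) (_ : IsAdmissible τS ψ),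
    hypDiv ε (tensorId N.toLin (Fin n) ψ) (N.toLin (trSnd ψ) ⊗ₖ trFst ψ)

/-- The message set `[2^R]`. -/
abbrev Msg (R : ℝ) : Type := Fin ⌊(2 : ℝ) ^ R⌋₊

/-- The pure state `|m⟩_M |θ⟩_{E_A E_B} |τ⟩_{S S'}`, with the registers `M E_A S'` held by Alice
placed first and the remaining registers `S E_B` second. -/
def initialVec {M EA EB S S' : Type*} [DecidableEq M] (θ : EA × EB → ℂ) (τ : S × S' → ℂ) (m : M) :
    (M × EA × S') × (S × EB) → ℂ :=
  fun x => (if x.1.1 = m then 1 else 0) * θ (x.1.2.1, x.2.2) * τ (x.2.1, x.1.2.2)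

/-- The state of the register `M'` after message `m` has been encoded, sent through the channel
and decoded. -/
def outputState {M EA EB A S S' B : Type*} [DecidableEq M] [Fintype M] [Fintype EA] [Fintype EB]
    [Fintype A] [Fintype S] [Fintype S'] [Fintype B]
    (N : Channel (A × S) B) (τ : S × S' → ℂ) (θ : EA × EB → ℂ)
    (enc : Channel (M × EA × S') A) (dec : Channel (B × EB) M) (m : M) : Matrix M M ℂ :=
  let encoded : Matrix (A × (S × EB)) (A × (S × EB)) ℂ :=
    tensorId enc.toLin (S × EB) (ketbra (initialVec θ τ m))
  let received : Matrix (B × EB) (B × EB) ℂ :=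
    tensorId N.toLin EB
      (encoded.submatrix (Equiv.prodAssoc A S EB) (Equiv.prodAssoc A S EB))
  dec.toLin received

/-- An `(R, err)`-entanglement assisted code for the channel `N_{AS→B}` with the state
`|τ⟩_{SS'}` shared between Alice (`S'`) and the channel (`S`). -/
structure EACode {A S S' B : Type*} [Fintype A] [Fintype S] [Fintype S'] [Fintype B]
    (N : Channel (A × S) B) (τ : S × S' → ℂ) (R err : ℝ) where
  EA : Type
  EB : Type
  [fintypeEA : Fintype EA]
  [fintypeEB : Fintype EB]
  θ : EA × EB → ℂ
  θ_unit : IsUnitVec θ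
  enc : Channel (Msg R × EA × S') A
  dec : Channel (B × EB) (Msg R)
  error_le : ∀ m : Msg R,
    ∑ m' ∈ Finset.univ.erase m, (outputState N τ θ enc dec m m' m').re ≤ err

end QIT

/-! The proof is position-based coding. With `k = ⌊2 ^ R⌋`, Alice and Bob share `k` purifications of
`ψ_{B'}`, one per message, Bob holding the `B'` halves. Since `ψ_{SB'} = τ_S ⊗ ψ_{B'}`, the `m`-th
purification together with `τ` purifies the `SB'` marginal of `ψ`. Uhlmann's theorem
(`exists_kraus_of_marginal_eq`) then lets Alice, acting on her `m`-th half and `S'`, turn it into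
`ψ_{ASB'}` with Bob's `m`-th half as `B'` (`exists_encoder`).

After transmission, the output and copy `m` are in the state `N(ψ_{ASB'})`, while the output and any
other copy are in `N(ψ_{AS}) ⊗ ψ_{B'}`. A hypothesis test `Λ` between these two states, applied to
copy `j`, thus accepts with probability at least `1 - ε` if `j = m`, and otherwise with the
probability `t` of a false alarm.

The square-root measurement built from the `k` tests decodes. By `hayashi_nagaoka`, its error for
each message is at most `(1 + c) ε + (2 + c + 1/c) (k - 1) t` for every `c > 0`, so no averaging
over messages is needed. The rate condition gives `(k - 1) t ≤ δ² / (4ε)`, and `c = δ / ε` yields `ε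
+ 2δ`. -/

namespace QIT

open Matrix

/-! ### Square roots, operator monotonicity and the Hayashi–Nagaoka inequality. -/

section MatrixAnalysis

variable {n : Type*} [Fintype n] [DecidableEq n]

/-- A positive semidefinite matrix `G` has a square root `Q` with a commuting Moore–Penrose
inverse `Z`. -/
lemma exists_sqrt_pinv {G : Matrix n n ℂ} (hG : G.PosSemidef) :
    ∃ Q Z : Matrix n n ℂ, Q.PosSemidef ∧ Z.IsHermitian ∧ Q * Q = G ∧ Z * Q = Q * Z ∧
      Z * Q * Z = Z ∧ Q * Z * Q = Q := by
  set U : Matrix n n ℂ := (hG.1.eigenvectorUnitary).1 with hU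
  have hUU : Uᴴ * U = 1 := by
    rw [← star_eq_conjTranspose]; exact Unitary.coe_star_mul_self _
  set l := hG.1.eigenvalues with hl
  have hl0 : ∀ i, 0 ≤ l i := hG.eigenvalues_nonneg
  have hGd : G = U * diagonal (fun i => (l i : ℂ)) * Uᴴ := by
    have := hG.1.spectral_theorem
    rw [Unitary.conjStarAlgAut_apply] at this
    exact this
  have key : ∀ f g : n → ℂ, (U * diagonal f * Uᴴ) * (U * diagonal g * Uᴴ)
      = U * diagonal (fun i => f i * g i) * Uᴴ := by
    intro f g
    calc _ = U * diagonal f * (Uᴴ * U) * diagonal g * Uᴴ := by simp only [Matrix.mul_assoc]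
      _ = _ := by rw [hUU, Matrix.mul_one, Matrix.mul_assoc U, diagonal_mul_diagonal]
  have hherm : ∀ f : n → ℝ, (diagonal fun i => (f i : ℂ)).IsHermitian := fun f => by
    rw [IsHermitian, diagonal_conjTranspose]
    congr 1; ext i; simp
  -- The convention `0⁻¹ = 0` makes the entrywise inverse of the spectrum a pseudo-inverse.
  refine ⟨U * diagonal (fun i => ((Real.sqrt (l i) : ℝ) : ℂ)) * Uᴴ,
    U * diagonal (fun i => (((Real.sqrt (l i))⁻¹ : ℝ) : ℂ)) * Uᴴ, ?_, ?_, ?_, ?_, ?_, ?_⟩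
  · apply PosSemidef.mul_mul_conjTranspose_same
    apply PosSemidef.diagonal
    intro i
    simp only [Pi.zero_apply, Complex.zero_le_real]
    exact Real.sqrt_nonneg _
  · exact isHermitian_mul_mul_conjTranspose _ (hherm _)
  · rw [key, hGd]
    congr 3; ext i
    rw [← Complex.ofReal_mul, Real.mul_self_sqrt (hl0 i)]
  · rw [key, key]; simp only [mul_comm]
  · rw [key, key]
    congr 3; ext i
    by_cases h : Real.sqrt (l i) = 0
    · simp [h]
    · rw [← Complex.ofReal_mul, ← Complex.ofReal_mul]; field_simp
  · rw [key, key]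
    congr 3; ext i
    by_cases h : Real.sqrt (l i) = 0
    · simp [h]
    · rw [← Complex.ofReal_mul, ← Complex.ofReal_mul]; field_simp

lemma exists_conjTranspose_mul_self {G : Matrix n n ℂ} (hG : G.PosSemidef) :
    ∃ C : Matrix n n ℂ, G = Cᴴ * C := by
  obtain ⟨Q, -, hQ, -, h, -⟩ := exists_sqrt_pinv hG
  exact ⟨Q, by rw [hQ.1.eq, h]⟩

/-- Operator monotonicity of the square root. -/
lemma posSemidef_sub_of_sq {X Y : Matrix n n ℂ} (hX : X.PosSemidef) (hY : Y.PosSemidef)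
    (h : (Y * Y - X * X).PosSemidef) : (Y - X).PosSemidef := by
  have hD : (Y - X).IsHermitian := hY.1.sub hX.1
  rw [hD.posSemidef_iff_eigenvalues_nonneg]
  intro i
  by_contra hlt
  simp only [Pi.zero_apply, not_le] at hlt
  set a := hD.eigenvalues i with ha
  set v : n → ℂ := (hD.eigenvectorBasis i).ofLp with hv
  have hv0 : v ≠ 0 := by
    have := hD.eigenvectorBasis.orthonormal.ne_zero i
    intro h0
    exact this ((WithLp.ofLp_eq_zero 2).1 h0)
  have hDv : (Y - X) *ᵥ v = (a : ℂ) • v := by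
    rw [hv, hD.mulVec_eigenvectorBasis i]; rfl
  have hvD : star v ᵥ* (Y - X) = (a : ℂ) • star v := by
    have := congrArg star hDv
    rw [star_mulVec, hD.eq, star_smul] at this
    simpa using this
  -- An eigenvector of `Y - X` with eigenvalue `a < 0` turns the symmetrised factorisation of `Y² -
  -- X²` into `2a⟨X + Y⟩`. Nonnegativity then forces `⟨X⟩ = ⟨Y⟩ = 0`, against `⟨Y⟩ - ⟨X⟩ = a‖v‖² <
  -- 0`.
  have e1 : star v ⬝ᵥ (Y * Y - X * X) *ᵥ v + star v ⬝ᵥ (Y * Y - X * X) *ᵥ v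
      = (2 * a : ℂ) * (star v ⬝ᵥ (X + Y) *ᵥ v) := by
    have : (Y * Y - X * X) + (Y * Y - X * X) = (Y - X) * (X + Y) + (X + Y) * (Y - X) := by
      noncomm_ring
    rw [← dotProduct_add, ← add_mulVec, this, add_mulVec, dotProduct_add, ← mulVec_mulVec,
      ← mulVec_mulVec, hDv, dotProduct_mulVec, hvD, mulVec_smul, smul_dotProduct, dotProduct_smul,
      smul_eq_mul]
    ring
  have hx := hX.re_dotProduct_nonneg v
  have hy := hY.re_dotProduct_nonneg v
  have hs := h.re_dotProduct_nonneg v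
  have e3 : (star v ⬝ᵥ Y *ᵥ v).re - (star v ⬝ᵥ X *ᵥ v).re = a * (star v ⬝ᵥ v).re := by
    have : star v ⬝ᵥ (Y - X) *ᵥ v = (a : ℂ) * (star v ⬝ᵥ v) := by
      rw [hDv, dotProduct_smul, smul_eq_mul]
    rw [sub_mulVec, dotProduct_sub] at this
    have := congrArg Complex.re this
    simpa using this
  have hvv : 0 < (star v ⬝ᵥ v).re := by
    have : 0 < star v ⬝ᵥ v := dotProduct_star_self_pos_iff.2 hv0
    exact (Complex.lt_def.1 this).1
  have e4 := congrArg Complex.re e1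
  rw [add_mulVec, dotProduct_add] at e4
  simp only [Complex.add_re, Complex.mul_re, Complex.re_ofNat, Complex.ofReal_re, Complex.im_ofNat,
    Complex.ofReal_im, Complex.mul_im] at e4
  simp only [RCLike.re_to_complex] at hx hy hs
  have hxy : (star v ⬝ᵥ X *ᵥ v).re + (star v ⬝ᵥ Y *ᵥ v).re = 0 := by
    refine le_antisymm ?_ (add_nonneg hx hy)
    by_contra! hpos
    have := mul_neg_of_neg_of_pos hlt hpos
    linarith
  have := mul_neg_of_neg_of_pos hlt hvv
  linarith

/-- `Z * Q` is a Hermitian idempotent, so its complement is an orthogonal projection. In the decoder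
this is the part missed by the square-root measurement. -/
lemma posSemidef_one_sub_mul {Q Z : Matrix n n ℂ} (hQ : Q.IsHermitian) (hZ : Z.IsHermitian)
    (hcomm : Z * Q = Q * Z) (hZQZ : Z * Q * Z = Z) : (1 - Z * Q).PosSemidef := by
  have hh : (1 - Z * Q)ᴴ = 1 - Z * Q := by
    rw [conjTranspose_sub, conjTranspose_mul, conjTranspose_one, hZ.eq, hQ.eq, hcomm]
  have := posSemidef_conjTranspose_mul_self (1 - Z * Q)
  rw [hh] at this
  convert this using 1
  have : Z * Q * (Z * Q) = Z * Q := by rw [← Matrix.mul_assoc, hZQZ]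
  simp only [Matrix.sub_mul, Matrix.mul_sub, Matrix.one_mul, Matrix.mul_one, this]
  simp

/-- The Hayashi–Nagaoka inequality, tested against a positive functional. The square-root
measurement operator `Z` depends only on `S + T`. -/
lemma hayashi_nagaoka {G Q Z S T : Matrix n n ℂ} (hQ : Q.PosSemidef) (hZ : Z.IsHermitian)
    (hQQ : Q * Q = G) (hcomm : Z * Q = Q * Z) (hZQZ : Z * Q * Z = Z) (hQZQ : Q * Z * Q = Q)
    (hG : S + T = G) (hS : S.PosSemidef) (hS1 : (1 - S).PosSemidef) (hT : T.PosSemidef)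
    (F : Matrix n n ℂ →ₗ[ℝ] ℝ) (hF : ∀ X, X.PosSemidef → 0 ≤ F X) {c : ℝ} (hc : 0 < c) :
    F 1 - F (Z * S * Z) ≤ (1 + c) * (F 1 - F S) + (2 + c + 1 / c) * F T := by
  have hSS : (S - S * S).PosSemidef := by
    have h1 := hS.conjTranspose_mul_mul_same (1 - S)
    have h2 := hS1.conjTranspose_mul_mul_same S
    have := h1.add h2
    rw [hS1.1.eq, hS.1.eq] at this
    convert this using 1
    noncomm_ring
  -- `S² ≤ S ≤ S + T = Q²`, and the square root is operator monotone.
  have hSQ : (Q - S).PosSemidef := by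
    apply posSemidef_sub_of_sq hS hQ
    rw [hQQ, ← hG]
    convert hSS.add hT using 1
    noncomm_ring
  have hP := posSemidef_one_sub_mul hQ.1 hZ hcomm hZQZ
  have hA : (Z - 1).IsHermitian := hZ.sub isHermitian_one
  -- Once the products with `S` are eliminated through `Z G = G Z = Q`, right side minus left side
  -- is exactly `p1 / c + (1 + c) p2 + 2 (1 + c) p3 + c p4`.
  have p1 : 0 ≤ F ((1 - c • (Z - 1)) * T * (1 - c • (Z - 1))) := by
    apply hF
    have := hT.conjTranspose_mul_mul_same (1 - c • (Z - 1))
    rwa [conjTranspose_sub, conjTranspose_one, conjTranspose_smul, hA.eq, star_trivial] at this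
  have p2 : 0 ≤ F ((Z - 1) * S * (Z - 1)) := by
    apply hF
    have := hS.conjTranspose_mul_mul_same (Z - 1)
    rwa [hA.eq] at this
  have p3 := hF _ hSQ
  have p4 := hF _ hP
  have hZG : Z * G = Q := by rw [← hQQ, ← Matrix.mul_assoc, hcomm, hQZQ]
  have hGZ : G * Z = Q := by rw [← hQQ, Matrix.mul_assoc, ← hcomm, ← Matrix.mul_assoc, hQZQ]
  have hZGZ : Z * G * Z = Z * Q := by rw [hZG, hcomm]
  rw [← hG] at hZG hGZ hZGZ
  have r1 : F (Z * S) + F (Z * T) = F Q := by rw [← map_add, ← Matrix.mul_add, hZG]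
  have r2 : F (S * Z) + F (T * Z) = F Q := by rw [← map_add, ← Matrix.add_mul, hGZ]
  have r3 : F (Z * S * Z) + F (Z * T * Z) = F (Z * Q) := by
    rw [← map_add, ← Matrix.add_mul, ← Matrix.mul_add, hZGZ]
  simp only [Matrix.sub_mul, Matrix.mul_sub, Matrix.one_mul, Matrix.mul_one, smul_mul_assoc,
    mul_smul_comm, map_sub, map_smul, smul_eq_mul, smul_sub] at p1 p2 p3 p4
  have p1' : 0 ≤ (1 / c) * F T - (F (Z * T) - F T) - (F (T * Z) - F T)
      + c * (F (Z * T * Z) - F (Z * T) - F (T * Z) + F T) := by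
    have := mul_nonneg (one_div_pos.2 hc).le p1
    refine this.trans (le_of_eq ?_)
    field_simp
    ring
  have p2' := mul_nonneg (by linarith : (0 : ℝ) ≤ 1 + c) p2
  have p3' := mul_nonneg (by linarith : (0 : ℝ) ≤ 2 * (1 + c)) p3
  have p4' := mul_nonneg hc.le p4
  have e1 : F (Z * S) = F Q - F (Z * T) := by linarith
  have e2 : F (S * Z) = F Q - F (T * Z) := by linarith
  have e3 : F (Z * S * Z) = F (Z * Q) - F (Z * T * Z) := by linarith
  rw [e1, e2, e3] at p2'
  rw [e3]
  linarith

lemma trace_mul_re_nonneg {X ρ : Matrix n n ℂ} (hX : X.PosSemidef) (hρ : ρ.PosSemidef) :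
    0 ≤ (X * ρ).trace.re := by
  obtain ⟨C, rfl⟩ := exists_conjTranspose_mul_self hX
  have := (hρ.mul_mul_conjTranspose_same C).trace_nonneg
  rw [trace_mul_comm, ← Matrix.mul_assoc] at this
  exact (Complex.le_def.1 this).1

end MatrixAnalysis

/-! ### Complete positivity, Kraus operators and measurements. -/

section Channels

/-- Complete positivity is postulated for ancillas `Fin k`; relabelling the basis covers every
finite ancilla. -/
lemma Channel.posSemidef_tensorId {ι ι' κ : Type*} [Fintype ι] [Fintype ι'] [Fintype κ]
    (Φ : Channel ι ι') {X : Matrix (ι × κ) (ι × κ) ℂ} (hX : X.PosSemidef) :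
    (tensorId Φ.toLin κ X).PosSemidef := by
  let e := Fintype.equivFin κ
  have h := Φ.completelyPositive _ _ (hX.submatrix (Prod.map id e.symm))
  convert h.submatrix (Prod.map id e) using 1
  ext x y
  simp [tensorId]

lemma trace_tensorId {ι ι' κ : Type*} [Fintype ι] [Fintype ι'] [Fintype κ]
    (Φ : Channel ι ι') (X : Matrix (ι × κ) (ι × κ) ℂ) :
    (tensorId Φ.toLin κ X).trace = X.trace := by
  simp only [Matrix.trace, diag_apply, Fintype.sum_prod_type_right]
  exact Finset.sum_congr rfl fun k _ => Φ.tracePreserving (of fun i j => X (i, k) (j, k))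

/-- The linear map with Kraus operators `K`. -/
noncomputable def krausLin {ι ι' κ : Type*} [Fintype ι] [Fintype κ] (K : κ → Matrix ι' ι ℂ) :
    Matrix ι ι ℂ →ₗ[ℂ] Matrix ι' ι' ℂ where
  toFun X := ∑ k, K k * X * (K k)ᴴ
  map_add' X Y := by simp only [Matrix.mul_add, Matrix.add_mul, Finset.sum_add_distrib]
  map_smul' c X := by simp [Finset.smul_sum]

lemma krausLin_apply {ι ι' κ : Type*} [Fintype ι] [Fintype κ] (K : κ → Matrix ι' ι ℂ)
    (X : Matrix ι ι ℂ) : krausLin K X = ∑ k, K k * X * (K k)ᴴ := rfl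

/-- The channel with Kraus operators `K`. -/
noncomputable def krausChannel {ι ι' κ : Type*} [Fintype ι] [Fintype ι'] [Fintype κ]
    [DecidableEq ι] (K : κ → Matrix ι' ι ℂ) (hK : ∑ k, (K k)ᴴ * K k = 1) : Channel ι ι' where
  toLin := krausLin K
  completelyPositive n X hX := by
    have : tensorId (krausLin K) (Fin n) X
        = ∑ k, (K k ⊗ₖ (1 : Matrix (Fin n) (Fin n) ℂ)) * X
          * (K k ⊗ₖ (1 : Matrix (Fin n) (Fin n) ℂ))ᴴ := by
      ext x y
      simp only [tensorId, krausLin_apply, of_apply, Matrix.sum_apply]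
      refine Finset.sum_congr rfl fun k _ => ?_
      simp [Matrix.mul_apply, Fintype.sum_prod_type, one_apply, kroneckerMap_apply,
        conjTranspose_apply, apply_ite star, mul_ite]
    rw [this]
    exact posSemidef_sum _ fun k _ => hX.mul_mul_conjTranspose_same _
  tracePreserving X := by
    rw [krausLin_apply, trace_sum]
    simp_rw [fun k => trace_mul_cycle (K k) X (K k)ᴴ]
    rw [← trace_sum, ← Finset.sum_mul, hK, Matrix.one_mul]

lemma tensorId_krausChannel_ketbra {ι ι' κ η : Type*} [Fintype ι] [Fintype ι'] [Fintype κ]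
    [DecidableEq ι] (K : κ → Matrix ι' ι ℂ) (hK : ∑ k, (K k)ᴴ * K k = 1) (w : ι × η → ℂ)
    (x y : ι' × η) :
    tensorId (krausChannel K hK).toLin η (ketbra w) x y
      = ∑ k, (∑ i, K k x.1 i * w (i, x.2)) * star (∑ i, K k y.1 i * w (i, y.2)) := by
  simp only [tensorId, krausChannel, krausLin_apply, of_apply, Matrix.sum_apply]
  refine Finset.sum_congr rfl fun k _ => ?_
  simp only [Matrix.mul_apply, of_apply, ketbra, vecMulVec_apply, conjTranspose_apply,
    Pi.star_apply, star_sum, star_mul', Finset.sum_mul, Finset.mul_sum]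
  refine Finset.sum_congr rfl fun i _ => Finset.sum_congr rfl fun j _ => ?_
  ring

/-- The measurement channel of a POVM. -/
lemma exists_measurementChannel {ι M : Type*} [Fintype ι] [DecidableEq ι] [Fintype M]
    [DecidableEq M] {G : M → Matrix ι ι ℂ} (hG : ∀ m, (G m).PosSemidef) (hG1 : ∑ m, G m = 1) :
    ∃ D : Channel ι M, ∀ X m, D.toLin X m m = (G m * X).trace := by
  choose C hC using fun m => exists_conjTranspose_mul_self (hG m)
  let K : M × ι → Matrix M ι ℂ := fun p => of fun m y => if m = p.1 then C p.1 p.2 y else 0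
  have hK : ∑ p, (K p)ᴴ * K p = 1 := by
    rw [← hG1, Fintype.sum_prod_type]
    refine Finset.sum_congr rfl fun m _ => ?_
    rw [hC]
    ext y y'
    simp [K, Matrix.sum_apply, Matrix.mul_apply, apply_ite star]
  refine ⟨krausChannel K hK, fun X m => ?_⟩
  rw [hC, Matrix.mul_assoc, trace_mul_comm]
  simp only [krausChannel, krausLin_apply, Matrix.sum_apply, Fintype.sum_prod_type, Matrix.trace,
    diag_apply]
  rw [Finset.sum_eq_single m]
  · refine Finset.sum_congr rfl fun x _ => ?_
    simp [K, Matrix.mul_apply]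
  · intro b _ hb
    refine Finset.sum_eq_zero fun x _ => ?_
    simp [K, Matrix.mul_apply, hb.symm]
  · simp

end Channels

/-! ### Uhlmann's theorem for equal marginals. -/

section Uhlmann

/-- The Gram matrix of `W (1 - P)` vanishes, hence so does `W (1 - P)`. -/
lemma mul_eq_self_of_gram {X L : Type*} [Fintype X] [Fintype L] [DecidableEq X]
    (W : Matrix L X ℂ) {P : Matrix X X ℂ} (h : Wᴴ * W * P = Wᴴ * W) : W * P = W := by
  have : W * (1 - P) = 0 := by
    rw [← conjTranspose_mul_self_eq_zero, conjTranspose_mul, Matrix.mul_assoc,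
      ← Matrix.mul_assoc Wᴴ, Matrix.mul_sub (Wᴴ * W), h, Matrix.mul_one, sub_self,
      Matrix.mul_zero]
  rw [Matrix.mul_sub, Matrix.mul_one, sub_eq_zero] at this
  exact this.symm

/-- Matrices with the same Gram matrix are related by a contraction, completed to an isometry by
an operator vanishing on the range. -/
lemma exists_isometry_of_gram_eq {X K L : Type*} [Fintype X] [Fintype K] [Fintype L]
    [DecidableEq K] (V : Matrix K X ℂ) (W : Matrix L X ℂ) (h : Wᴴ * W = Vᴴ * V) :
    ∃ (U : Matrix L K ℂ) (D : Matrix K K ℂ), U * V = W ∧ D * V = 0 ∧ Uᴴ * U + Dᴴ * D = 1 := by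
  classical
  obtain ⟨Q, Z, hQ, hZ, hQQ, hc, hZQZ, hQZQ⟩ :=
    exists_sqrt_pinv (posSemidef_conjTranspose_mul_self V)
  set G := Vᴴ * V with hG
  have hGP : G * (Z * Q) = G := by
    rw [← hQQ, Matrix.mul_assoc, ← Matrix.mul_assoc Q Z Q, hQZQ]
  have hZZG : Z * Z * G = Z * Q := by
    rw [← hQQ, ← Matrix.mul_assoc, Matrix.mul_assoc Z Z Q, hc, ← Matrix.mul_assoc, hZQZ, hc]
  have hGG : Z * Z * G * (Z * Z) = Z * Z := by
    rw [hZZG, ← Matrix.mul_assoc, hZQZ]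
  have hVP : V * (Z * Q) = V := mul_eq_self_of_gram V hGP
  have hWP : W * (Z * Q) = W := mul_eq_self_of_gram W (by rw [h, hGP])
  have hUU : (W * (Z * Z) * Vᴴ)ᴴ * (W * (Z * Z) * Vᴴ) = V * (Z * Z) * Vᴴ := by
    calc _ = V * (Z * Z) * (Wᴴ * W) * (Z * Z) * Vᴴ := by
          simp only [conjTranspose_mul, conjTranspose_conjTranspose, hZ.eq, Matrix.mul_assoc]
      _ = V * (Z * Z * G * (Z * Z)) * Vᴴ := by rw [h]; simp only [Matrix.mul_assoc]
      _ = _ := by rw [hGG]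
  have hPP : (V * (Z * Z) * Vᴴ) * (V * (Z * Z) * Vᴴ) = V * (Z * Z) * Vᴴ := by
    calc _ = V * (Z * Z * G * (Z * Z)) * Vᴴ := by simp only [hG, Matrix.mul_assoc]
      _ = _ := by rw [hGG]
  have hPh : (V * (Z * Z) * Vᴴ)ᴴ = V * (Z * Z) * Vᴴ := by
    simp only [conjTranspose_mul, conjTranspose_conjTranspose, hZ.eq, Matrix.mul_assoc]
  -- `Z * Z` is the pseudo-inverse of `Vᴴ V`, so `V (Z * Z) Vᴴ` is the projection onto the range of
  -- `V`. It equals `Uᴴ U`, and `D` is its complement; no comparison of the sizes of `K` and `L` is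
  -- needed.
  refine ⟨W * (Z * Z) * Vᴴ, 1 - V * (Z * Z) * Vᴴ, ?_, ?_, ?_⟩
  · rw [Matrix.mul_assoc, ← hG, Matrix.mul_assoc, hZZG, hWP]
  · rw [Matrix.sub_mul, Matrix.one_mul, Matrix.mul_assoc _ Vᴴ, ← hG, Matrix.mul_assoc, hZZG, hVP,
      sub_self]
  · rw [hUU, conjTranspose_sub, conjTranspose_one, hPh]
    simp only [Matrix.sub_mul, Matrix.mul_sub, hPP, Matrix.one_mul, Matrix.mul_one]
    simp

/-- Uhlmann's theorem for equal marginals: a purification `V` of the marginal of `ψ` on the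
register `X` is mapped to `ψ` by a channel acting on the purifying register. -/
lemma exists_kraus_of_marginal_eq {A X K : Type*} [Fintype A] [Fintype X] [Fintype K]
    [DecidableEq K] [Nonempty A] {ψ : Matrix (A × X) (A × X) ℂ} (hψ : ψ.PosSemidef)
    (V : Matrix K X ℂ) (h : ∀ x x', trFst ψ x x' = ∑ r, V r x * star (V r x')) :
    ∃ T : (A × X) ⊕ K → Matrix A K ℂ, ∑ k, (T k)ᴴ * T k = 1 ∧
      ∀ a x a' x', ∑ k, (T k * V) a x * star ((T k * V) a' x') = ψ (a, x) (a', x') := by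
  classical
  obtain ⟨C, hC⟩ := exists_conjTranspose_mul_self hψ
  -- A purification of `ψ` itself, with purifying register a copy of `A × X`; `A` is grouped with
  -- that register, so `W` and `V` purify the same marginal.
  let W : Matrix (A × (A × X)) X ℂ := of fun p x => star (C p.2 (p.1, x))
  have hW : Wᴴ * W = Vᴴ * V := by
    ext x x'
    have := h x' x
    simp only [hC, trFst, of_apply, Matrix.mul_apply, conjTranspose_apply] at this
    simp only [Matrix.mul_apply, conjTranspose_apply, W, of_apply, star_star,
      Fintype.sum_prod_type_right]
    rw [Finset.sum_comm] at this
    simp only [Fintype.sum_prod_type_right] at this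
    simp only [mul_comm (star _)] at *
    rw [← this]
  obtain ⟨U, D, hU, hD, hUD⟩ := exists_isometry_of_gram_eq V W hW
  obtain ⟨a₀⟩ := ‹Nonempty A›
  -- Tracing out the purifying register turns `U` into Kraus operators. Those from `D` restore trace
  -- preservation by preparing the fixed `a₀`, and vanish on `V`.
  refine ⟨Sum.elim (fun e => of fun a r => U (a, e) r)
    (fun r₀ => of fun a r => if a = a₀ then D r₀ r else 0), ?_, ?_⟩
  · rw [← hUD, Fintype.sum_sum_type]
    congr 1
    · ext r r'
      simp only [Sum.elim_inl, Matrix.sum_apply, Matrix.mul_apply, conjTranspose_apply, of_apply]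
      rw [Fintype.sum_prod_type_right (f := fun j => star (U j r) * U j r')]
    · ext r r'
      simp [Matrix.sum_apply, Matrix.mul_apply, apply_ite star]
  · intro a x a' x'
    have h1 : ∀ e a x, ((of fun a r => U (a, e) r) * V) a x = star (C e (a, x)) := by
      intro e a x
      have := congrFun (congrFun hU (a, e)) x
      simpa [Matrix.mul_apply, W] using this
    have h2 : ∀ r₀ a x, ((of fun a r => if a = a₀ then D r₀ r else 0) * V) a x = 0 := by
      intro r₀ a x
      have := congrFun (congrFun hD r₀) x
      simp only [Matrix.mul_apply, of_apply, Matrix.zero_apply] at this ⊢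
      by_cases ha : a = a₀ <;> simp [ha, this]
    rw [Fintype.sum_sum_type]
    simp only [Sum.elim_inl, Sum.elim_inr, h1, h2, zero_mul, Finset.sum_const_zero, add_zero,
      star_star]
    rw [hC]
    simp [Matrix.mul_apply]

end Uhlmann

/-! ### Operators that single out one of the shared copies. -/

section Position

variable {M α β : Type*} [Fintype M] [DecidableEq M]

lemma prod_ite_eq_mul_prod_erase (m : M) (a b : M → ℂ) :
    ∏ i, (if i = m then a i else b i) = a m * ∏ i ∈ Finset.univ.erase m, b i := by
  rw [← Finset.mul_prod_erase _ _ (Finset.mem_univ m), if_pos rfl]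
  congr 1
  exact Finset.prod_congr rfl fun i hi => if_neg (Finset.ne_of_mem_erase hi)

/-- The operator acting as `ω` on the first register and the `m`-th copy of the register `β`, and
as `ρ` on every other copy. -/
def positionOp (m : M) (ω : Matrix (α × β) (α × β) ℂ) (ρ : Matrix β β ℂ) :
    Matrix (α × (M → β)) (α × (M → β)) ℂ :=
  of fun p q => ∏ i, if i = m then ω (p.1, p.2 i) (q.1, q.2 i) else ρ (p.2 i) (q.2 i)

lemma positionOp_apply (m : M) (ω : Matrix (α × β) (α × β) ℂ) (ρ : Matrix β β ℂ)
    (p q : α × (M → β)) :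
    positionOp m ω ρ p q = ω (p.1, p.2 m) (q.1, q.2 m)
      * ∏ i ∈ Finset.univ.erase m, ρ (p.2 i) (q.2 i) :=
  prod_ite_eq_mul_prod_erase m (fun i => ω (p.1, p.2 i) (q.1, q.2 i)) fun i => ρ (p.2 i) (q.2 i)

/-- The Kronecker form, up to relabelling, lets the tests inherit positivity from `ω`. -/
lemma positionOp_one_right [DecidableEq β] (m : M) (ω : Matrix (α × β) (α × β) ℂ) :
    positionOp m ω 1 = (ω ⊗ₖ (1 : Matrix ({i // i ≠ m} → β) ({i // i ≠ m} → β) ℂ)).submatrix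
      (fun p : α × (M → β) => ((p.1, p.2 m), fun i => p.2 i))
      (fun p => ((p.1, p.2 m), fun i => p.2 i)) := by
  ext p q
  rw [positionOp_apply]
  simp only [submatrix_apply, kroneckerMap_apply, one_apply, Finset.prod_ite_zero,
    Finset.prod_const_one, Finset.mem_erase, Finset.mem_univ, and_true, funext_iff,
    Subtype.forall]

lemma posSemidef_positionOp_one_right [Fintype α] [Fintype β] [DecidableEq β] (m : M)
    {ω : Matrix (α × β) (α × β) ℂ} (hω : ω.PosSemidef) : (positionOp m ω 1).PosSemidef := by
  rw [positionOp_one_right]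
  exact (hω.kronecker PosSemidef.one).submatrix _

lemma positionOp_one_one [DecidableEq α] [DecidableEq β] (m : M) :
    positionOp m (1 : Matrix (α × β) (α × β) ℂ) 1 = 1 := by
  rw [positionOp_one_right, one_kronecker_one, submatrix_one]
  rintro ⟨a, e⟩ ⟨a', e'⟩ h
  simp only [Prod.mk.injEq, funext_iff, Subtype.forall] at h
  ext i
  · exact h.1.1
  · by_cases hi : i = m
    · subst hi; exact h.1.2
    · exact h.2 i hi

lemma one_sub_positionOp_one_right [DecidableEq α] [DecidableEq β] (m : M)
    (ω : Matrix (α × β) (α × β) ℂ) :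
    1 - positionOp m ω 1 = positionOp m (1 - ω) 1 := by
  rw [← positionOp_one_one m]
  ext p q
  simp only [Matrix.sub_apply, positionOp_apply]
  ring

lemma tensorId_positionOp {α' : Type*} (Φ : Matrix α α ℂ →ₗ[ℂ] Matrix α' α' ℂ) (m : M)
    (ω : Matrix (α × β) (α × β) ℂ) (ρ : Matrix β β ℂ) :
    tensorId Φ (M → β) (positionOp m ω ρ) = positionOp m (tensorId Φ β ω) ρ := by
  ext p q
  rw [positionOp_apply]
  simp only [tensorId, of_apply]
  have : (of fun i j => positionOp m ω ρ (i, p.2) (j, q.2))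
      = (∏ i ∈ Finset.univ.erase m, ρ (p.2 i) (q.2 i)) •
        of fun i j => ω (i, p.2 m) (j, q.2 m) := by
    ext i j
    simp only [of_apply, positionOp_apply, Matrix.smul_apply, smul_eq_mul]
    ring
  rw [this, map_smul, Matrix.smul_apply, smul_eq_mul, mul_comm]

variable [Fintype α] [Fintype β]

lemma sum_sum_prod (f : M → β → β → ℂ) :
    ∑ e : M → β, ∑ e' : M → β, ∏ i, f i (e i) (e' i) = ∏ i, ∑ x, ∑ y, f i x y := by
  rw [Fintype.prod_sum]
  exact Finset.sum_congr rfl fun e _ => (Fintype.prod_sum fun i y => f i (e i) y).symm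

lemma trace_positionOp_mul [DecidableEq β] (j m : M) (Λ ω : Matrix (α × β) (α × β) ℂ)
    (ρ : Matrix β β ℂ) :
    (positionOp j Λ 1 * positionOp m ω ρ).trace = ∑ a, ∑ a', ∏ i, ∑ x, ∑ y,
      (if i = j then Λ (a, x) (a', y) else (1 : Matrix β β ℂ) x y)
        * (if i = m then ω (a', y) (a, x) else ρ y x) := by
  simp only [← sum_sum_prod, Matrix.trace, diag_apply, Matrix.mul_apply, Fintype.sum_prod_type,
    positionOp, of_apply, ← Finset.prod_mul_distrib]
  exact Finset.sum_congr rfl fun a _ => Finset.sum_comm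

/-- Testing the right copy: each other copy contributes only a factor `tr ρ = 1`. -/
lemma trace_positionOp_mul_self [DecidableEq β] (m : M) (Λ ω : Matrix (α × β) (α × β) ℂ)
    {ρ : Matrix β β ℂ} (hρ : ρ.trace = 1) :
    (positionOp m Λ 1 * positionOp m ω ρ).trace = (Λ * ω).trace := by
  rw [trace_positionOp_mul]
  simp only [Matrix.trace, diag_apply, Matrix.mul_apply, Fintype.sum_prod_type]
  refine Finset.sum_congr rfl fun a _ => ?_
  rw [Finset.sum_comm (f := fun x a' => _)]
  refine Finset.sum_congr rfl fun a' _ => ?_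
  rw [Fintype.prod_eq_single m]
  · simp
  · intro i hi
    simpa [hi, one_apply, Matrix.trace] using hρ

/-- Testing a wrong copy: copy `m` is ignored, which reduces `ω` to its marginal, and the tested
copy `j` is an independent `ρ`. This produces the second argument of `D_H`. -/
lemma trace_positionOp_mul_of_ne [DecidableEq β] {j m : M} (hjm : j ≠ m)
    (Λ ω : Matrix (α × β) (α × β) ℂ) {ρ : Matrix β β ℂ} (hρ : ρ.trace = 1) :
    (positionOp j Λ 1 * positionOp m ω ρ).trace = (Λ * (trSnd ω ⊗ₖ ρ)).trace := by
  rw [trace_positionOp_mul]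
  simp only [Matrix.trace, diag_apply, Matrix.mul_apply, Fintype.sum_prod_type]
  refine Finset.sum_congr rfl fun a _ => ?_
  rw [Finset.sum_comm (f := fun x a' => _)]
  refine Finset.sum_congr rfl fun a' _ => ?_
  rw [Fintype.prod_eq_mul j m hjm]
  · simp only [if_true, if_neg hjm, if_neg hjm.symm, one_apply, kroneckerMap_apply, trSnd, of_apply,
      ite_mul, one_mul, zero_mul, Finset.sum_ite_eq, Finset.mem_univ]
    rw [Finset.sum_mul]
    refine Finset.sum_congr rfl fun x _ => ?_
    rw [Finset.sum_mul]
    refine Finset.sum_congr rfl fun y _ => ?_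
    ring
  · intro i hi
    simpa [hi.1, hi.2, one_apply, Matrix.trace] using hρ

end Position

/-! ### Decoding by the square-root measurement. -/

section Decoder

/-- The square-root measurement. -/
lemma exists_decoder {ι M : Type*} [Fintype ι] [DecidableEq ι] [Fintype M] [DecidableEq M]
    [Nonempty M] {S : M → Matrix ι ι ℂ} (hS : ∀ m, (S m).PosSemidef)
    (hS1 : ∀ m, (1 - S m).PosSemidef) :
    ∃ D : Channel ι M, ∀ ρ : Matrix ι ι ℂ, IsState ρ → ∀ m, ∀ c : ℝ, 0 < c →
      1 - (D.toLin ρ m m).re ≤ (1 + c) * (1 - (S m * ρ).trace.re)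
        + (2 + c + 1 / c) * ∑ m' ∈ Finset.univ.erase m, (S m' * ρ).trace.re := by
  obtain ⟨Q, Z, hQ, hZ, hQQ, hc, hZQZ, hQZQ⟩ :=
    exists_sqrt_pinv (posSemidef_sum Finset.univ fun m _ => hS m)
  obtain ⟨m₀⟩ := ‹Nonempty M›
  have hP := posSemidef_one_sub_mul hQ.1 hZ hc hZQZ
  have hZS : ∀ m, (Z * S m * Z).PosSemidef := fun m => by
    have := (hS m).conjTranspose_mul_mul_same Z
    rwa [hZ.eq] at this
  -- The operators `Z S_m Z` only sum to the projection `Z * Q`. The missing part goes to an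
  -- arbitrary message `m₀`, which cannot lower any success probability.
  have hsum : ∑ m, (Z * S m * Z + if m = m₀ then 1 - Z * Q else 0) = 1 := by
    rw [Finset.sum_add_distrib, ← Finset.sum_mul, ← Finset.mul_sum, ← hQQ]
    simp only [Finset.sum_ite_eq', Finset.mem_univ, if_true]
    rw [← Matrix.mul_assoc, Matrix.mul_assoc (Z * Q), ← hc, ← Matrix.mul_assoc, hZQZ]
    simp
  obtain ⟨D, hD⟩ := exists_measurementChannel (M := M) (fun m => (hZS m).add
    (show (if m = m₀ then 1 - Z * Q else 0).PosSemidef by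
      split_ifs
      · exact hP
      · exact PosSemidef.zero)) hsum
  refine ⟨D, fun ρ hρ m c hc0 => ?_⟩
  let F : Matrix ι ι ℂ →ₗ[ℝ] ℝ :=
    { toFun := fun X => (X * ρ).trace.re
      map_add' := fun X Y => by simp [Matrix.add_mul]
      map_smul' := fun r X => by simp }
  have hF : ∀ X, X.PosSemidef → 0 ≤ F X := fun X hX => trace_mul_re_nonneg hX hρ.1
  have hn := hayashi_nagaoka (T := ∑ m' ∈ Finset.univ.erase m, S m') hQ hZ hQQ hc hZQZ hQZQ
    (Finset.add_sum_erase _ _ (Finset.mem_univ m)) (hS m) (hS1 m)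
    (posSemidef_sum _ fun m' _ => hS m') F hF hc0
  have hF1 : F 1 = 1 := by simp [F, hρ.2]
  rw [hF1, map_sum] at hn
  refine le_trans ?_ hn
  rw [hD, Matrix.add_mul, Matrix.trace_add, Complex.add_re]
  have : 0 ≤ ((if m = m₀ then 1 - Z * Q else 0) * ρ).trace.re := by
    split_ifs
    · exact hF _ hP
    · simp
  change 1 - (F (Z * S m * Z) + _) ≤ 1 - F (Z * S m * Z)
  linarith

end Decoder

/-! ### Position-based encoding. -/

section Encoder

variable {M A S S' β κ : Type*} [Fintype M] [DecidableEq M] [Fintype β] [DecidableEq β]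

/-- Kraus operators applying `T` to the copy selected by the message and tracing out the other
copies. -/
def selectKraus (x₀ : β) (T : κ → Matrix A (β × S') ℂ) (p : M × (M → β) × κ) :
    Matrix A (M × (M → β) × S') ℂ :=
  of fun a y => if y.1 = p.1 then T p.2.2 a (y.2.1 p.1, y.2.2)
    * ∏ i, (if i = p.1 then (if p.2.1 i = x₀ then 1 else 0)
      else if y.2.1 i = p.2.1 i then 1 else 0) else 0

/-- The index `p.2.1` lists basis outcomes on the discarded copies. The selected copy has no such
outcome, and pinning its entry to `x₀` counts each Kraus operator once. -/
lemma sum_selectKraus [Fintype A] [DecidableEq S'] [Fintype κ] (x₀ : β)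
    {T : κ → Matrix A (β × S') ℂ} (hT : ∑ k, (T k)ᴴ * T k = 1) :
    ∑ p : M × (M → β) × κ, (selectKraus x₀ T p)ᴴ * selectKraus x₀ T p = 1 := by
  ext ⟨m, e, s⟩ ⟨m', e', s'⟩
  have hT' : ∀ r r', ∑ k, ∑ a, star (T k a r) * T k a r' = (1 : Matrix _ _ ℂ) r r' := by
    intro r r'
    rw [← hT]
    simp [Matrix.sum_apply, Matrix.mul_apply]
  simp only [Matrix.sum_apply, Fintype.sum_prod_type]
  rw [Finset.sum_eq_single m]
  rotate_left
  · intro b _ hb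
    refine Finset.sum_eq_zero fun c _ => Finset.sum_eq_zero fun k _ => ?_
    simp [Matrix.mul_apply, selectKraus, hb.symm]
  · simp
  by_cases hm : m' = m
  swap
  · rw [one_apply_ne (by simp [Ne.symm hm])]
    refine Finset.sum_eq_zero fun c _ => Finset.sum_eq_zero fun k _ => ?_
    simp [Matrix.mul_apply, selectKraus, hm]
  subst hm
  have hc : ∀ c : M → β, ∑ k, ((selectKraus x₀ T (m', c, k))ᴴ * selectKraus x₀ T (m', c, k))
      (m', e, s) (m', e', s') = (1 : Matrix (β × S') (β × S') ℂ) (e m', s) (e' m', s')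
      * ∏ i, (if i = m' then (if c i = x₀ then 1 else 0)
      else (if e i = c i then 1 else 0) * if e' i = c i then 1 else 0) := by
    intro c
    rw [← hT', Finset.sum_mul]
    refine Finset.sum_congr rfl fun k _ => ?_
    rw [Matrix.mul_apply, Finset.sum_mul]
    refine Finset.sum_congr rfl fun a _ => ?_
    simp only [conjTranspose_apply, selectKraus, of_apply, if_true, star_mul', star_prod]
    rw [mul_mul_mul_comm, ← Finset.prod_mul_distrib]
    congr 1
    refine Finset.prod_congr rfl fun i _ => ?_
    split_ifs <;> simp
  simp only [hc]
  rw [← Finset.mul_sum, ← Fintype.prod_sum (f := fun i ci => if i = m' then (if ci = x₀ then 1 else 0)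
      else (if e i = ci then 1 else 0) * if e' i = ci then 1 else 0)]
  have h1 : ∀ i, ∑ ci, (if i = m' then (if ci = x₀ then (1 : ℂ) else 0)
      else (if e i = ci then 1 else 0) * if e' i = ci then 1 else 0)
      = if i = m' then 1 else if e' i = e i then 1 else 0 := by
    intro i
    split_ifs <;> simp_all [eq_comm]
  simp only [h1]
  rw [prod_ite_eq_mul_prod_erase]
  simp only [one_apply, Finset.prod_ite_zero, Finset.prod_const_one, Prod.mk.injEq,
    Finset.mem_erase, Finset.mem_univ, and_true, true_and, ← ite_and, mul_ite, mul_one, mul_zero]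
  congr 1
  rw [eq_iff_iff]
  constructor
  · rintro ⟨h, he, hs⟩
    refine ⟨funext fun i => ?_, hs⟩
    by_cases hi : i = m'
    · rw [hi, he]
    · exact (h i hi).symm
  · rintro ⟨rfl, rfl⟩
    simp

/-- The amplitude factors over the copies, so the later sum over outcomes `c` becomes a product of
independent sums: `T k` acts on the selected copy, and every other one just records `c i`. -/
lemma selectKraus_initialVec [Fintype S'] (x₀ : β) (T : κ → Matrix A (β × S') ℂ) (μ : β → β → ℂ)
    (τ : S × S' → ℂ) (m m₁ : M) (c : M → β) (k : κ) (a : A) (s : S) (b : M → β) :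
    ∑ y, selectKraus x₀ T (m₁, c, k) a y
      * initialVec (fun p : (M → β) × (M → β) => ∏ i, μ (p.1 i) (p.2 i)) τ m (y, (s, b))
    = if m₁ = m then ∏ i, (if i = m then (if c i = x₀ then
        (T k * (of fun (r : β × S') (x : S × β) => μ r.1 x.2 * τ (x.1, r.2))) a (s, b i) else 0)
        else μ (c i) (b i)) else 0 := by
  by_cases hm : m₁ = m
  swap
  · rw [if_neg hm]
    refine Finset.sum_eq_zero fun y _ => ?_
    by_cases hy : y.1 = m₁
    · simp [initialVec, hy, hm]
    · simp [selectKraus, hy]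
  subst hm
  rw [if_pos rfl]
  simp only [Fintype.sum_prod_type, selectKraus, initialVec, of_apply]
  rw [Finset.sum_eq_single m₁ (fun b _ hb => by simp [hb]) (by simp)]
  simp only [if_true, one_mul]
  have h1 : ∀ e : M → β, ∑ s', T k a (e m₁, s')
      * (∏ i, (if i = m₁ then (if c i = x₀ then 1 else 0) else if e i = c i then 1 else 0))
      * ((∏ i, μ (e i) (b i)) * τ (s, s'))
      = ∏ i, (if i = m₁ then (if c i = x₀ then
        ∑ s', T k a (e i, s') * (μ (e i) (b i) * τ (s, s')) else 0)
        else if e i = c i then μ (e i) (b i) else 0) := by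
    intro e
    rw [prod_ite_eq_mul_prod_erase, prod_ite_eq_mul_prod_erase,
      ← Finset.mul_prod_erase _ (fun i => μ (e i) (b i)) (Finset.mem_univ m₁)]
    have : ∏ i ∈ Finset.univ.erase m₁, (if e i = c i then μ (e i) (b i) else 0)
        = (∏ i ∈ Finset.univ.erase m₁, if e i = c i then 1 else 0)
          * ∏ i ∈ Finset.univ.erase m₁, μ (e i) (b i) := by
      rw [← Finset.prod_mul_distrib]
      simp
    rw [this]
    split_ifs
    · rw [Finset.sum_mul]
      refine Finset.sum_congr rfl fun s' _ => ?_
      ring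
    · simp
  simp only [h1]
  rw [← Fintype.prod_sum (f := fun i x => if i = m₁ then (if c i = x₀ then
        ∑ s', T k a (x, s') * (μ x (b i) * τ (s, s')) else 0)
        else if x = c i then μ x (b i) else 0)]
  refine Finset.prod_congr rfl fun i _ => ?_
  split_ifs
  · simp [Matrix.mul_apply, Fintype.sum_prod_type]
  · simp
  · simp

/-- Position-based encoding: from shared purifications `μ` of `ρ`, Alice prepares `ψ` with the copy
selected by the message. -/
lemma exists_encoder [Fintype A] [Nonempty A] [Fintype S] [Fintype S']
    {ψ : Matrix ((A × S) × β) ((A × S) × β) ℂ} (hψ : ψ.PosSemidef)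
    (x₀ : β) {ρ : Matrix β β ℂ} (μ : β → β → ℂ) (hμ : ∀ b b', ∑ x, μ x b * star (μ x b') = ρ b b')
    (τ : S × S' → ℂ) (h : margSB ψ = trSnd (ketbra τ) ⊗ₖ ρ) :
    ∃ enc : Channel (M × (M → β) × S') A, ∀ m : M,
      (tensorId enc.toLin (S × (M → β)) (ketbra (initialVec
        (fun p : (M → β) × (M → β) => ∏ i, μ (p.1 i) (p.2 i)) τ m))).submatrix
        (Equiv.prodAssoc A S (M → β)) (Equiv.prodAssoc A S (M → β)) = positionOp m ψ ρ := by
  classical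
  -- The product of one shared purification and `τ`, with Alice's registers as rows. By hypothesis
  -- `h` it purifies the `SB'` marginal of `ψ`, as Uhlmann's theorem requires.
  let V : Matrix (β × S') (S × β) ℂ := of fun r x => μ r.1 x.2 * τ (x.1, r.2)
  obtain ⟨T, hT, hTV⟩ := exists_kraus_of_marginal_eq
    (hψ.submatrix (Equiv.prodAssoc A S β).symm) V (by
      rintro ⟨s, b⟩ ⟨s', b'⟩
      have := congrFun (congrFun h (s, b)) (s', b')
      simp only [margSB, of_apply, kroneckerMap_apply, trSnd, ketbra, vecMulVec_apply,
        Pi.star_apply] at this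
      simp only [trFst, of_apply, submatrix_apply, Equiv.prodAssoc_symm_apply, this, V]
      rw [← hμ, Finset.sum_mul_sum, Finset.sum_comm, Fintype.sum_prod_type]
      refine Finset.sum_congr rfl fun x _ => Finset.sum_congr rfl fun s' _ => ?_
      rw [star_mul']
      ring)
  refine ⟨krausChannel (selectKraus x₀ T) (sum_selectKraus x₀ hT), fun m => ?_⟩
  ext ⟨⟨a, s⟩, b⟩ ⟨⟨a', s'⟩, b'⟩
  rw [submatrix_apply, tensorId_krausChannel_ketbra]
  simp only [Equiv.prodAssoc_apply]
  rw [Fintype.sum_prod_type, Finset.sum_eq_single m]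
  rotate_left
  · intro m₁ _ hm
    refine Finset.sum_eq_zero fun p _ => ?_
    rw [selectKraus_initialVec, if_neg hm, zero_mul]
  · simp
  rw [Fintype.sum_prod_type_right]
  have hk : ∀ k, ∑ c : M → β, (∑ y, selectKraus x₀ T (m, c, k) a y
      * initialVec (fun p : (M → β) × (M → β) => ∏ i, μ (p.1 i) (p.2 i)) τ m (y, (s, b)))
      * star (∑ y, selectKraus x₀ T (m, c, k) a' y
      * initialVec (fun p : (M → β) × (M → β) => ∏ i, μ (p.1 i) (p.2 i)) τ m (y, (s', b')))
      = ((T k * V) a (s, b m) * star ((T k * V) a' (s', b' m)))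
        * ∏ i ∈ Finset.univ.erase m, ρ (b i) (b' i) := by
    intro k
    rw [← prod_ite_eq_mul_prod_erase m (fun i => (T k * V) a (s, b i) *
      star ((T k * V) a' (s', b' i))) (fun i => ρ (b i) (b' i))]
    have : ∀ i, (if i = m then (T k * V) a (s, b i) * star ((T k * V) a' (s', b' i))
        else ρ (b i) (b' i)) = ∑ x, (if i = m then (if x = x₀ then (T k * V) a (s, b i) else 0)
        else μ x (b i)) * star (if i = m then (if x = x₀ then (T k * V) a' (s', b' i) else 0)
        else μ x (b' i)) := by
      intro i
      split_ifs
      · simp [apply_ite star]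
      · exact (hμ _ _).symm
    simp only [this, Fintype.prod_sum, Finset.prod_mul_distrib]
    refine Finset.sum_congr rfl fun c _ => ?_
    rw [selectKraus_initialVec, selectKraus_initialVec, if_pos rfl, if_pos rfl, star_prod]
  simp only [hk]
  rw [← Finset.sum_mul, hTV, positionOp_apply]
  rfl

end Encoder

/-! ### Marginals, purifications and the code obtained from one test. -/

lemma trSnd_tensorId {α α' κ : Type*} [Fintype κ] (Φ : Matrix α α ℂ →ₗ[ℂ] Matrix α' α' ℂ)
    (X : Matrix (α × κ) (α × κ) ℂ) : trSnd (tensorId Φ κ X) = Φ (trSnd X) := by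
  have : trSnd X = ∑ k, of fun i j => X (i, k) (j, k) := by
    ext i j
    simp [trSnd, Matrix.sum_apply]
  rw [this, map_sum]
  ext i j
  simp [trSnd, tensorId, Matrix.sum_apply]

lemma posSemidef_trFst {ι κ : Type*} [Fintype ι] {X : Matrix (ι × κ) (ι × κ) ℂ}
    (hX : X.PosSemidef) : (trFst X).PosSemidef := by
  have : trFst X = ∑ i, X.submatrix (fun k => (i, k)) fun k => (i, k) := by
    ext k k'
    simp [trFst, Matrix.sum_apply]
  rw [this]
  exact posSemidef_sum _ fun i _ => hX.submatrix _

lemma trace_trFst {ι κ : Type*} [Fintype ι] [Fintype κ] (X : Matrix (ι × κ) (ι × κ) ℂ) :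
    (trFst X).trace = X.trace := by
  simp [Matrix.trace, trFst, Fintype.sum_prod_type_right]

/-- Every state has a purification by a copy of its register. -/
lemma exists_purification {β : Type*} [Fintype β] [DecidableEq β] {ρ : Matrix β β ℂ}
    (hρ : ρ.PosSemidef) :
    ∃ μ : β → β → ℂ, ∀ b b', ∑ x, μ x b * star (μ x b') = ρ b b' := by
  obtain ⟨C, rfl⟩ := exists_conjTranspose_mul_self hρ
  exact ⟨fun x b => star (C x b), fun b b' => by simp [Matrix.mul_apply]⟩

/-- The squared norm factors over the copies, each factor being `tr ρ = 1`. -/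
lemma isUnitVec_prod {M β : Type*} [Fintype M] [DecidableEq M] [Fintype β]
    {ρ : Matrix β β ℂ} (hρ : ρ.trace = 1) {μ : β → β → ℂ}
    (hμ : ∀ b b', ∑ x, μ x b * star (μ x b') = ρ b b') :
    IsUnitVec fun p : (M → β) × (M → β) => ∏ i, μ (p.1 i) (p.2 i) := by
  have h1 : ∑ x, ∑ y, ‖μ x y‖ ^ 2 = 1 := by
    have : ((∑ x, ∑ y, ‖μ x y‖ ^ 2 : ℝ) : ℂ) = 1 := by
      rw [← hρ, Finset.sum_comm]
      push_cast
      refine Finset.sum_congr rfl fun y _ => ?_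
      rw [diag_apply, ← hμ]
      exact Finset.sum_congr rfl fun x _ => (Complex.mul_conj' (μ x y)).symm
    exact_mod_cast this
  simp only [IsUnitVec, Fintype.sum_prod_type, norm_prod, ← Finset.prod_pow]
  have h2 : ∀ e : M → β, ∑ e' : M → β, ∏ i, ‖μ (e i) (e' i)‖ ^ 2
      = ∏ i, ∑ y, ‖μ (e i) y‖ ^ 2 :=
    fun e => (Fintype.prod_sum fun i y => ‖μ (e i) y‖ ^ 2).symm
  simp only [h2]
  rw [← Fintype.prod_sum (f := fun _ x => ∑ y, ‖μ x y‖ ^ 2)]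
  simp [h1]

/-- If the logarithm of `1 / t` exceeds `log ((k - 1/2) / s)`, then `(k - 1) t ≤ s`. -/
lemma sub_one_mul_le_of_lt_logInv {k s t : ℝ} (hk : 1 ≤ k) (hs : 0 < s)
    (h : ((Real.logb 2 (k - 1 / 2) + Real.logb 2 (1 / s) : ℝ) : EReal) < logInv t) :
    (k - 1) * t ≤ s := by
  unfold logInv at h
  split_ifs at h with ht
  · rw [ht, mul_zero]; exact hs.le
  -- For `t < 0` the value of `logInv` carries no information, but the claim is trivial since `k ≥
  -- 1`.
  · rcases lt_or_gt_of_ne ht with ht | ht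
    · nlinarith
    · have hk' : 0 < k - 1 / 2 := by linarith
      rw [EReal.coe_lt_coe_iff, ← Real.logb_mul hk'.ne' (one_div_pos.2 hs).ne',
        Real.logb_lt_logb_iff one_lt_two (mul_pos hk' (one_div_pos.2 hs)) (one_div_pos.2 ht),
        mul_one_div, div_lt_div_iff₀ hs ht] at h
      nlinarith

/-- Position-based coding with a fixed admissible state `ψ` and a fixed test `Λ`. -/
lemma exists_code_of_test {A S S' B β : Type*} [Fintype A] [Fintype S] [Fintype S'] [Fintype B]
    [DecidableEq B] [Fintype β] [DecidableEq β] {M : Type*} [Fintype M] [DecidableEq M]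
    [Nonempty M] (N : Channel (A × S) B) (τ : S × S' → ℂ)
    {ψ : Matrix ((A × S) × β) ((A × S) × β) ℂ} (hψ : IsAdmissible (trSnd (ketbra τ)) ψ)
    {Λ : Matrix (B × β) (B × β) ℂ} (hΛ : Λ.PosSemidef) (hΛ1 : (1 - Λ).PosSemidef) :
    ∃ (θ : (M → β) × (M → β) → ℂ) (enc : Channel (M × (M → β) × S') A)
      (dec : Channel (B × (M → β)) M), IsUnitVec θ ∧ ∀ m, ∀ c : ℝ, 0 < c →
      ∑ m' ∈ Finset.univ.erase m, (outputState N τ θ enc dec m m' m').re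
        ≤ (1 + c) * (1 - (Λ * tensorId N.toLin β ψ).trace.re) + (2 + c + 1 / c)
          * ((Fintype.card M - 1) * (Λ * (N.toLin (trSnd ψ) ⊗ₖ trFst ψ)).trace.re) := by
  obtain ⟨⟨hpos, htr⟩, hmarg⟩ := hψ
  have hne : Nonempty ((A × S) × β) := by
    by_contra hE
    rw [not_nonempty_iff] at hE
    simp [Matrix.trace] at htr
  obtain ⟨⟨a₀, s₀⟩, x₀⟩ := hne
  have : Nonempty A := ⟨a₀⟩
  have hρ1 : (trFst ψ).trace = 1 := (trace_trFst ψ).trans htr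
  obtain ⟨μ, hμ⟩ := exists_purification (posSemidef_trFst hpos)
  obtain ⟨enc, henc⟩ := exists_encoder (M := M) hpos x₀ μ hμ τ hmarg
  obtain ⟨dec, hdec⟩ := exists_decoder (M := M) (S := fun m : M => positionOp m Λ 1)
    (fun m => posSemidef_positionOp_one_right m hΛ)
    (fun m => by
      rw [one_sub_positionOp_one_right]
      exact posSemidef_positionOp_one_right m hΛ1)
  refine ⟨_, enc, dec, isUnitVec_prod hρ1 hμ, fun m c hc => ?_⟩
  have hrec : outputState N τ (fun p : (M → β) × (M → β) => ∏ i, μ (p.1 i) (p.2 i)) enc dec m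
      = dec.toLin (positionOp m (tensorId N.toLin β ψ) (trFst ψ)) := by
    rw [← tensorId_positionOp, ← henc m]
    rfl
  have hstate : IsState (positionOp m (tensorId N.toLin β ψ) (trFst ψ)) := by
    constructor
    · rw [← tensorId_positionOp, ← henc m]
      exact N.posSemidef_tensorId
        ((enc.posSemidef_tensorId (posSemidef_vecMulVec_self_star _)).submatrix _)
    -- The trivial test `Λ = 1` computes the trace.
    · have := trace_positionOp_mul_self m 1 (tensorId N.toLin β ψ) hρ1
      rwa [positionOp_one_one, Matrix.one_mul, Matrix.one_mul, trace_tensorId, htr] at this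
  have h1 := hdec _ hstate m c hc
  have h2 : ∑ m' ∈ Finset.univ.erase m, (positionOp m' Λ 1
      * positionOp m (tensorId N.toLin β ψ) (trFst ψ)).trace.re
      = (Fintype.card M - 1) * (Λ * (N.toLin (trSnd ψ) ⊗ₖ trFst ψ)).trace.re := by
    rw [Finset.sum_congr rfl fun m' hm' => by
      rw [trace_positionOp_mul_of_ne (Finset.ne_of_mem_erase hm') _ _ hρ1, trSnd_tensorId]]
    rw [Finset.sum_const, Finset.card_erase_of_mem (Finset.mem_univ m), Finset.card_univ,
      nsmul_eq_mul, Nat.cast_sub Fintype.card_pos, Nat.cast_one]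
  rw [h2, trace_positionOp_mul_self m _ _ hρ1] at h1
  refine le_trans (le_of_eq ?_) h1
  -- The decoder preserves the trace, so the error sum is `1` minus the `m`-th diagonal entry.
  have htd := dec.tracePreserving (positionOp m (tensorId N.toLin β ψ) (trFst ψ))
  rw [hstate.2] at htd
  have htd' := congrArg Complex.re htd
  simp only [Matrix.trace, diag_apply, Complex.re_sum, Complex.one_re] at htd'
  rw [← Finset.add_sum_erase _ _ (Finset.mem_univ m)] at htd'
  rw [hrec]
  linarith

end QIT

/-! ### Choice of the test and of the constants. -/

theorem theorem4 {A S S' B : Type*} [Fintype A] [Fintype S] [Fintype S'] [Fintype B]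
    [DecidableEq B] (N : QIT.Channel (A × S) B)
    (τ : S × S' → ℂ) (hτ : QIT.IsUnitVec τ)
    (ε δ : ℝ) (hε : ε ∈ Set.Ioo (0 : ℝ) 1) (hδ : δ ∈ Set.Ioo (0 : ℝ) 1) (hδε : δ ≤ ε)
    (R : ℝ) (hR0 : 0 ≤ R)
    (hR : (R : EReal) ≤ QIT.maxHypDiv N (QIT.trSnd (QIT.ketbra τ)) ε
      - ((Real.logb 2 (4 * ε / δ ^ 2) : ℝ) : EReal)) :
    Nonempty (QIT.EACode N τ R (ε + 2 * δ)) := by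
  obtain ⟨hε0, -⟩ := hε
  obtain ⟨hδ0, -⟩ := hδ
  have hk1 : 1 ≤ ⌊(2 : ℝ) ^ R⌋₊ := by
    rw [Nat.one_le_floor_iff]
    exact Real.one_le_rpow one_le_two hR0
  have hkR : (⌊(2 : ℝ) ^ R⌋₊ : ℝ) ≤ 2 ^ R := Nat.floor_le (by positivity)
  have hk1' : (1 : ℝ) ≤ ⌊(2 : ℝ) ^ R⌋₊ := by exact_mod_cast hk1
  -- The supremum need not be attained, so a strict inequality is needed to extract `ψ` and `Λ`.
  -- Only `k - 1` messages compete, which leaves room to replace `k` by `k - 1/2`.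
  have hlog : Real.logb 2 (⌊(2 : ℝ) ^ R⌋₊ - 1 / 2) < R := by
    rw [Real.logb_lt_iff_lt_rpow one_lt_two (by linarith)]
    linarith
  have hs : 0 < δ ^ 2 / (4 * ε) := by positivity
  have hlt : ((Real.logb 2 (⌊(2 : ℝ) ^ R⌋₊ - 1 / 2) + Real.logb 2 (1 / (δ ^ 2 / (4 * ε))) : ℝ) :
      EReal) < QIT.maxHypDiv N (QIT.trSnd (QIT.ketbra τ)) ε := by
    have h1 := EReal.add_le_of_le_sub hR
    refine lt_of_lt_of_le ?_ h1
    rw [← EReal.coe_add, EReal.coe_lt_coe_iff, one_div_div]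
    linarith
  simp only [QIT.maxHypDiv, QIT.hypDiv, lt_iSup_iff] at hlt
  obtain ⟨n, ψ, hψ, Λ, ⟨hΛ, hΛ1, hΛε⟩, ht⟩ := hlt
  have ht' := QIT.sub_one_mul_le_of_lt_logInv hk1' hs ht
  have : Nonempty (QIT.Msg R) := ⟨⟨0, hk1⟩⟩
  obtain ⟨θ, enc, dec, hθ, herr⟩ := QIT.exists_code_of_test (M := QIT.Msg R) N τ hψ hΛ hΛ1
  refine ⟨⟨QIT.Msg R → Fin n, QIT.Msg R → Fin n, θ, hθ, enc, dec, fun m => ?_⟩⟩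
  -- With `c = δ / ε`, `(1 + c) ε = ε + δ`, and `(2 + c + 1/c) δ² / (4ε) = δ (1 + c)² / 4 ≤ δ`
  -- because `c ≤ 1`; this is the origin of the `4` in the rate.
  refine (herr m (δ / ε) (div_pos hδ0 hε0)).trans ?_
  rw [Fintype.card_fin]
  have hc1 : δ / ε ≤ 1 := (div_le_one hε0).2 hδε
  have hc0 : 0 < δ / ε := div_pos hδ0 hε0
  have b1 : (1 + δ / ε) * (1 - (Λ * QIT.tensorId N.toLin (Fin n) ψ).trace.re)
      ≤ (1 + δ / ε) * ε := mul_le_mul_of_nonneg_left (by linarith) (by linarith)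
  have b2 := mul_le_mul_of_nonneg_left ht' (by positivity : 0 ≤ 2 + δ / ε + 1 / (δ / ε))
  have b3 : (1 + δ / ε) * ε = ε + δ := by field_simp
  have b4 : (2 + δ / ε + 1 / (δ / ε)) * (δ ^ 2 / (4 * ε)) ≤ δ := by
    have : (2 + δ / ε + 1 / (δ / ε)) * (δ ^ 2 / (4 * ε))
        = δ * ((2 * (δ / ε) + (δ / ε) ^ 2 + 1) / 4) := by
      field_simp
    rw [this]
    nlinarith
  linarith
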